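/- For $a>0$, $n\in\mathbb{Z}_{\ge 0}$ and real $\nu$ let $$c_n^a(\nu)=\sum_{k=0}^n\binom nk\binom{\nu}{k}k!\,(-a)^{-k},\qquad \binom{\nu}{k}=\frac{\nu(\nu-1)\cdots(\nu-k+1)}{k!},$$ be the Charlier polynomials, and for real $\nu,x$ let $$H_\nu(x)=2^\nu\sqrt\pi\left[\frac{1}{\Gamma(\frac{1-\nu}{2})}M\!\left(-\tfrac{\nu}{2};\tfrac12;x^2\right)-\frac{2x}{\Gamma(-\frac{\nu}{2})}M\!\left(\tfrac{1-\nu}{2};\tfrac32;x^2\right)\right]$$ be the Hermite function, where $M(p;q;z)=\sum_{k\ge0}\frac{(p)_k}{(q)_k}\frac{z^k}{k!}$, with $(p)_k=p(p+1)\cdots(p+k-1)$, is the confluent hypergeometric function of the first kind and $1/\Gamma$ is $0$ at non-positive integers. Put $$y_\nu^a(x)=(2a)^{\nu/2}\,c^a_{\lceil a-x\sqrt{2a}\rceil}(\nu),$$ which is defined whenever $a>0$ and $\lceil a-x\sqrt{2a}\rceil\ge 0$. (i) $y_\nu^a(x)=H_\nu(x)+O(1/\sqrt a)$ as $a\to\infty$,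 uniformly for $x$ and $\nu$ in bounded intervals: for all bounded intervals $[x_0,x_1]$ and $[\nu_0,\nu_1]$ there are constants $C$ and $a_0>0$ such that for all $a\ge a_0$, $x\in[x_0,x_1]$ and $\nu\in[\nu_0,\nu_1]$ we have $\lceil a-x\sqrt{2a}\rceil\ge0$ and $$\left|y_\nu^a(x)-H_\nu(x)\right|\le \frac{C}{\sqrt a}.$$ (ii) For $\nu=2$, every real $x$ and every $a>0$ such that $a-x\sqrt{2a}$ is a non-negative integer, $$y_2^a(x)-H_2(x)=\frac{2\sqrt2\,x}{\sqrt a},$$ and for every real $x$ there are arbitrarily large such $a$. In particular the rate is sharp: there are $\nu$, $x$ and $c\ne0$ such that $y_\nu^a(x)-H_\nu(x)=c/\sqrt a$ for arbitrarily large $a$. -/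

import Mathlib

noncomputable section

/-- The binomial coefficient `x (x - 1) ⋯ (x - k + 1) / k!` with a real upper argument. -/
def realBinom (x : ℝ) (k : ℕ) : ℝ :=
  (∏ j ∈ Finset.range k, (x - (j : ℝ))) / (k.factorial : ℝ)

/-- The Charlier polynomial `c_n^a(x) = ∑_{k=0}^n C(n,k) C(x,k) k! (-a)^{-k}`. -/
def charlier (a : ℝ) (n : ℕ) (x : ℝ) : ℝ :=
  ∑ k ∈ Finset.range (n + 1),
    (n.choose k : ℝ) * realBinom x k * (k.factorial : ℝ) * ((-a) ^ k)⁻¹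

/-- The confluent hypergeometric function of the first kind
`M(p; q; z) = ∑_k (p)_k / (q)_k * z^k / k!`, with `(p)_k` the rising factorial. The series
converges for all real `p`, `z` and every real `q` that is not a non-positive integer. -/
def kummerM (p q z : ℝ) : ℝ :=
  ∑' k : ℕ, (ascPochhammer ℝ k).eval p / (ascPochhammer ℝ k).eval q *
    (z ^ k / (k.factorial : ℝ))

/-- The Hermite function of real degree `ν`. At the poles of the Gamma function
`Real.Gamma` takes the value `0`, so that its inverse is `0` there, which is the limiting value of
the reciprocal Gamma function. -/
def hermiteFn (ν x : ℝ) : ℝ :=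
  (2 : ℝ) ^ ν * √Real.pi *
    ((Real.Gamma ((1 - ν) / 2))⁻¹ * kummerM (-ν / 2) (1 / 2) (x ^ 2) -
      2 * x * (Real.Gamma (-ν / 2))⁻¹ * kummerM ((1 - ν) / 2) (3 / 2) (x ^ 2))

/-- The scaled Charlier polynomial `(2a)^{ν/2} c^a_{⌈a - x√(2a)⌉}(ν)`, for `a > 0` and
`⌈a - x√(2a)⌉ ≥ 0`. -/
def scaledCharlier (a x ν : ℝ) : ℝ :=
  (2 * a) ^ (ν / 2) * charlier a ⌈a - x * √(2 * a)⌉₊ ν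

end

/-!
For `p = -ν > 0` both functions are Mellin-type integrals. Replacing `Γ(p + k)` by its Euler
integral in the Charlier sum, and rescaling by `r = √(2a)`, gives
`Γ(p) r ^ (-p) c_n^a(-p) = ∫₀^∞ s ^ (p - 1) e ^ (-rs) (1 + rs / a) ^ n ds`
(`integral_rpow_mul_exp_mul_pow_eq_charlier`), while integrating the power series of `e ^ (-2xs)`
termwise against a Gaussian gives, by the duplication formula for `Γ`,
`Γ(p) H_{-p}(x) = ∫₀^∞ s ^ (p - 1) e ^ (-s² - 2xs) ds` (`integral_rpow_mul_exp_eq_hermiteFn`).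

With `n = a - xr + O(1)`, the logarithms of the two factors beside `s ^ (p - 1)` differ by
`O(1 / √a)` times a cubic polynomial in `s`, for all `s > 0` (`abs_log_integrand_sub_le`), and for
large `a` both factors are at most `K e ^ (-s)` (`log_charlier_integrand_le`, `neg_sq_sub_le`). So
the integrals differ by `O(1 / √a)` times a combination of `Γ(p + 1)`, `Γ(p + 2)` and `Γ(p + 3)`;
after division by `Γ(p)` these are polynomials in `p`, and the estimate is uniform for `ν` in
`[-A, 0)` (`abs_scaledCharlier_sub_hermiteFn_neg_le`). The same integral bounds `H_ν`.

Upward propagation in `ν` uses the recurrences `H_{ν+1} = 2x H_ν - 2ν H_{ν-1}`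
(`hermiteFn_add_one`), which reduces to two contiguous relations of the Kummer series, and
`y_{ν+1} = (r / a) (ν + a - n) y_ν - 2ν y_{ν-1}` (`scaledCharlier_add_one`), the difference equation
of the Charlier polynomials. As `(r / a) (ν + a - n) = 2x + O(1 / √a)`, an error of order `1 / √a`
together with local boundedness of `H` on `[-A, N)` passes to `[-A, N + 1)`
(`exists_bound_of_lt_nat`).

For `ν = 2` both sides are explicit polynomials. The equation `a - x√(2a) = n` is quadratic in
`√a`, with a positive root that tends to infinity with `n`.
-/

/-! ### The Kummer series and its contiguous relations -/

theorem ascPochhammer_eval_succ_left (p : ℝ) (k : ℕ) :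
    (ascPochhammer ℝ (k + 1)).eval p = p * (ascPochhammer ℝ k).eval (p + 1) := by
  simp [ascPochhammer_succ_left]

/-- The quotient of Pochhammer symbols grows at most geometrically, so that the Kummer series is
dominated by an exponential series. -/
theorem abs_ascPochhammer_div_le {p q : ℝ} (hq : 0 < q) (k : ℕ) :
    |(ascPochhammer ℝ k).eval p / (ascPochhammer ℝ k).eval q| ≤ (|p| / q + 1) ^ k := by
  induction k with
  | zero => simp
  | succ k ih =>
    have hqk : 0 < q + k := by positivity
    rw [ascPochhammer_succ_eval, ascPochhammer_succ_eval, mul_div_mul_comm, abs_mul, pow_succ]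
    refine mul_le_mul ih ?_ (abs_nonneg _) (by positivity)
    rw [abs_div, abs_of_pos hqk, div_le_iff₀ hqk]
    have h1 : |p + k| ≤ |p| + k := by simpa using abs_add_le p (k : ℝ)
    have h2 : (|p| / q + 1) * (q + k) = |p| + k + (q + |p| / q * k) := by field_simp; ring
    have h3 : 0 ≤ q + |p| / q * k := by positivity
    linarith

theorem summable_kummerM_term (p : ℝ) {q : ℝ} (hq : 0 < q) (z : ℝ) :
    Summable fun k : ℕ ↦ (ascPochhammer ℝ k).eval p / (ascPochhammer ℝ k).eval q *
      (z ^ k / (k.factorial : ℝ)) := by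
  refine Summable.of_norm_bounded (Real.summable_pow_div_factorial ((|p| / q + 1) * |z|))
    fun k ↦ ?_
  rw [Real.norm_eq_abs, abs_mul, abs_div (z ^ k), abs_pow, Nat.abs_cast, mul_pow, mul_div_assoc]
  exact mul_le_mul_of_nonneg_right (abs_ascPochhammer_div_le hq k) (by positivity)

theorem hasSum_kummerM (p : ℝ) {q : ℝ} (hq : 0 < q) (z : ℝ) :
    HasSum (fun k : ℕ ↦ (ascPochhammer ℝ k).eval p / (ascPochhammer ℝ k).eval q *
      (z ^ k / (k.factorial : ℝ))) (kummerM p q z) :=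
  (summable_kummerM_term p hq z).hasSum

theorem ascPochhammer_eval_pos {q : ℝ} (hq : 0 < q) (k : ℕ) :
    0 < (ascPochhammer ℝ k).eval q := ascPochhammer_pos k q hq

/-- Contiguous relation behind the even part, in `x`, of the Hermite recurrence. -/
theorem kummerM_half_sub (p z : ℝ) :
    kummerM p (1 / 2) z - kummerM (p - 1) (1 / 2) z = 2 * z * kummerM p (3 / 2) z := by
  have h1 := (hasSum_kummerM p (q := 1 / 2) (by norm_num) z).sub
    (hasSum_kummerM (p - 1) (q := 1 / 2) (by norm_num) z)
  have h2 := (hasSum_kummerM p (q := 3 / 2) (by norm_num) z).mul_left (2 * z)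
  refine h1.unique ((hasSum_nat_add_iff' 1).mp ?_)
  simp only [Finset.sum_range_one, ascPochhammer_zero, Polynomial.eval_one, sub_self, sub_zero]
  refine h2.congr_fun fun k ↦ ?_
  have e1 := ascPochhammer_succ_eval k p
  have e2 := ascPochhammer_eval_succ_left (p - 1) k
  have e3 := ascPochhammer_eval_succ_left (1 / 2) k
  have a3 := ascPochhammer_eval_pos (q := 3 / 2) (by norm_num) k
  rw [sub_add_cancel] at e2
  rw [show (1 / 2 + 1 : ℝ) = 3 / 2 by norm_num] at e3
  rw [e1, e2, e3, Nat.factorial_succ]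
  push_cast
  field_simp
  ring

/-- Contiguous relation behind the odd part, in `x`, of the Hermite recurrence. -/
theorem kummerM_three_halves_eq (p z : ℝ) :
    (1 - 2 * p) * kummerM p (3 / 2) z =
      kummerM p (1 / 2) z - 2 * p * kummerM (p + 1) (3 / 2) z := by
  have h1 := (hasSum_kummerM p (q := 1 / 2) (by norm_num) z).sub
    ((hasSum_kummerM (p + 1) (q := 3 / 2) (by norm_num) z).mul_left (2 * p))
  have h2 := (hasSum_kummerM p (q := 3 / 2) (by norm_num) z).mul_left (1 - 2 * p)
  refine h2.unique (h1.congr_fun fun k ↦ ?_)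
  have e1 := (ascPochhammer_succ_eval k p).symm.trans (ascPochhammer_eval_succ_left p k)
  have e2 := (ascPochhammer_succ_eval k (1 / 2 : ℝ)).symm.trans
    (ascPochhammer_eval_succ_left (1 / 2) k)
  have a1 := ascPochhammer_eval_pos (q := 1 / 2) (by norm_num) k
  have a3 := ascPochhammer_eval_pos (q := 3 / 2) (by norm_num) k
  rw [show (1 / 2 + 1 : ℝ) = 3 / 2 by norm_num] at e2
  rw [← sub_eq_zero]
  have e2' : (ascPochhammer ℝ k).eval (3 / 2 : ℝ) =
      (ascPochhammer ℝ k).eval (1 / 2 : ℝ) * (1 + 2 * k) := by linear_combination (-2) * e2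
  rw [e2']
  have hk : (0 : ℝ) < 1 + 2 * k := by positivity
  field_simp
  linear_combination (-2) * z ^ k * e1

/-! ### The three-term recurrences in the degree -/

/-- `1 / Γ(s) = s / Γ(s + 1)` for every real `s`, with the value `0` at the poles. -/
theorem inv_Gamma_eq (s : ℝ) : (Real.Gamma s)⁻¹ = s * (Real.Gamma (s + 1))⁻¹ := by
  rcases eq_or_ne s 0 with rfl | hs
  · simp [Real.Gamma_zero]
  · rw [Real.Gamma_add_one hs, mul_inv, ← mul_assoc, mul_inv_cancel₀ hs, one_mul]

/-- The recurrence in the degree, for every real `ν`. Since `1 / Γ(s) = s / Γ(s + 1)` also at the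
poles, integer degrees are no exception. -/
theorem hermiteFn_add_one (ν x : ℝ) :
    hermiteFn (ν + 1) x = 2 * x * hermiteFn ν x - 2 * ν * hermiteFn (ν - 1) x := by
  have g1 := inv_Gamma_eq (-ν / 2)
  have g2 := inv_Gamma_eq (-(ν + 1) / 2)
  have k1 := kummerM_half_sub ((1 - ν) / 2) (x ^ 2)
  have k2 := kummerM_three_halves_eq (-ν / 2) (x ^ 2)
  have p1 : (2 : ℝ) ^ (ν + 1) = 2 ^ ν * 2 := Real.rpow_add_one two_ne_zero ν
  have p2 : (2 : ℝ) ^ (ν - 1) = 2 ^ ν / 2 := Real.rpow_sub_one two_ne_zero ν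
  unfold hermiteFn
  rw [p1, p2]
  rw [show (1 - (ν + 1)) / 2 = -ν / 2 by ring, show (1 - (ν - 1)) / 2 = -ν / 2 + 1 by ring,
    show -(ν - 1) / 2 = (1 - ν) / 2 by ring]
  rw [show -(ν + 1) / 2 + 1 = (1 - ν) / 2 by ring] at g2
  rw [show (1 - ν) / 2 - 1 = -(ν + 1) / 2 by ring] at k1
  rw [g1, g2]
  generalize (Real.Gamma (-ν / 2 + 1))⁻¹ = G at *
  generalize (Real.Gamma ((1 - ν) / 2))⁻¹ = G' at *
  have k1' := congrArg (fun t ↦ 2 ^ ν * √Real.pi * G * ν * t) k1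
  have k2' := congrArg (fun t ↦ 2 ^ ν * √Real.pi * G' * 2 * x * t) k2
  beta_reduce at k1' k2'
  linear_combination k1' + k2'

theorem realBinom_mul_factorial (x : ℝ) (k : ℕ) :
    realBinom x k * k.factorial = ∏ j ∈ Finset.range k, (x - (j : ℝ)) := by
  unfold realBinom
  field_simp

theorem charlier_eq_sum_prod (a : ℝ) (n : ℕ) (x : ℝ) :
    charlier a n x = ∑ k ∈ Finset.range (n + 1),
      (n.choose k : ℝ) * ((-a) ^ k)⁻¹ * ∏ j ∈ Finset.range k, (x - (j : ℝ)) := by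
  refine Finset.sum_congr rfl fun k _ ↦ ?_
  rw [← realBinom_mul_factorial]
  ring

theorem mul_prod_sub_one (x : ℝ) (k : ℕ) :
    x * ∏ j ∈ Finset.range k, (x - 1 - (j : ℝ)) = ∏ j ∈ Finset.range (k + 1), (x - (j : ℝ)) := by
  rw [Finset.prod_range_succ']
  simp [mul_comm, sub_sub, add_comm]

/-- The difference equation of the Charlier polynomials. -/
theorem mul_charlier_add_one {a : ℝ} (ha : a ≠ 0) (n : ℕ) (x : ℝ) :
    a * charlier a n (x + 1) = (x + a - n) * charlier a n x - x * charlier a n (x - 1) := by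
  -- the forward difference lowers the degree of the falling factorials by one
  have hd : a * (charlier a n (x + 1) - charlier a n x) = ∑ k ∈ Finset.range (n + 1),
      (k - n : ℝ) * (n.choose k : ℝ) * ((-a) ^ k)⁻¹ * ∏ j ∈ Finset.range k, (x - (j : ℝ)) := by
    rw [charlier_eq_sum_prod, charlier_eq_sum_prod, ← Finset.sum_sub_distrib, Finset.mul_sum,
      Finset.sum_range_succ', Finset.sum_range_succ]
    simp only [Finset.range_zero, Finset.prod_empty, sub_self, mul_zero, add_zero, zero_mul]
    refine Finset.sum_congr rfl fun k hk ↦ ?_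
    have hc : (n.choose (k + 1) : ℝ) * (k + 1) = n.choose k * (n - k) := by
      have := Nat.choose_succ_right_eq n k
      rw [← Nat.cast_sub (Finset.mem_range.mp hk).le]
      exact_mod_cast this
    have hp := mul_prod_sub_one (x + 1) k
    rw [add_sub_cancel_right] at hp
    rw [← hp, Finset.prod_range_succ, pow_succ]
    have ha' : (-a) ≠ 0 := neg_ne_zero.mpr ha
    field_simp
    linear_combination (- ∏ j ∈ Finset.range k, (x - (j : ℝ))) * hc
  have hb : x * (charlier a n x - charlier a n (x - 1)) = ∑ k ∈ Finset.range (n + 1),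
      (k : ℝ) * (n.choose k : ℝ) * ((-a) ^ k)⁻¹ * ∏ j ∈ Finset.range k, (x - (j : ℝ)) := by
    rw [charlier_eq_sum_prod, charlier_eq_sum_prod, ← Finset.sum_sub_distrib, Finset.mul_sum]
    refine Finset.sum_congr rfl fun k _ ↦ ?_
    have hp := mul_prod_sub_one x k
    rw [Finset.prod_range_succ] at hp
    linear_combination (- (n.choose k : ℝ) * ((-a) ^ k)⁻¹) * hp
  have hn : n * charlier a n x = ∑ k ∈ Finset.range (n + 1),
      (n : ℝ) * (n.choose k : ℝ) * ((-a) ^ k)⁻¹ * ∏ j ∈ Finset.range k, (x - (j : ℝ)) := by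
    rw [charlier_eq_sum_prod, Finset.mul_sum]
    exact Finset.sum_congr rfl fun k _ ↦ by ring
  have hs : a * (charlier a n (x + 1) - charlier a n x) =
      x * (charlier a n x - charlier a n (x - 1)) - n * charlier a n x := by
    rw [hd, hb, hn, ← Finset.sum_sub_distrib]
    exact Finset.sum_congr rfl fun k _ ↦ by ring
  linear_combination hs

/-- The degree `⌈a - x√(2a)⌉₊` of the Charlier polynomial does not depend on `ν`, so the difference
equation becomes a recurrence for the scaled polynomials. -/
theorem scaledCharlier_add_one {a : ℝ} (ha : 0 < a) (x ν : ℝ) :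
    scaledCharlier a x (ν + 1) =
      √(2 * a) / a * (ν + a - ⌈a - x * √(2 * a)⌉₊) * scaledCharlier a x ν -
        2 * ν * scaledCharlier a x (ν - 1) := by
  have h2 : 0 < 2 * a := by positivity
  have e1 : (2 * a) ^ ((ν + 1) / 2) = (2 * a) ^ (ν / 2) * √(2 * a) := by
    rw [Real.sqrt_eq_rpow, ← Real.rpow_add h2]; ring_nf
  have e2 : (2 * a) ^ (ν / 2) * √(2 * a) = (2 * a) ^ ((ν - 1) / 2) * (2 * a) := by
    conv_rhs => rw [← Real.rpow_add_one h2.ne']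
    rw [Real.sqrt_eq_rpow, ← Real.rpow_add h2]; ring_nf
  have h := mul_charlier_add_one ha.ne' ⌈a - x * √(2 * a)⌉₊ ν
  unfold scaledCharlier
  rw [e1]
  generalize ⌈a - x * √(2 * a)⌉₊ = n at *
  field_simp
  linear_combination (2 * a) ^ (ν / 2) * √(2 * a) * h - ν * charlier a n (ν - 1) * e2

section NegativeDegree

open MeasureTheory Set

/-! ### Integral representations for negative degree -/

theorem Gamma_add_natCast_eq {p : ℝ} (hp : 0 < p) (k : ℕ) :
    Real.Gamma (p + k) = (ascPochhammer ℝ k).eval p * Real.Gamma p := by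
  induction k with
  | zero => simp
  | succ k ih =>
    have : p + k ≠ 0 := by positivity
    rw [Nat.cast_succ, ← add_assoc, Real.Gamma_add_one this, ih, ascPochhammer_succ_eval]
    ring

theorem factorial_two_mul_eq (m : ℕ) :
    ((2 * m).factorial : ℝ) = 4 ^ m * m.factorial * (ascPochhammer ℝ m).eval (1 / 2) := by
  induction m with
  | zero => simp
  | succ m ih =>
    rw [show 2 * (m + 1) = 2 * m + 1 + 1 by ring, Nat.factorial_succ, Nat.factorial_succ,
      ascPochhammer_succ_eval, Nat.factorial_succ]
    push_cast
    rw [ih]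
    ring

theorem factorial_two_mul_add_one_eq (m : ℕ) :
    ((2 * m + 1).factorial : ℝ) =
      4 ^ m * m.factorial * (ascPochhammer ℝ m).eval (3 / 2) := by
  have e2 := (ascPochhammer_succ_eval m (1 / 2 : ℝ)).symm.trans
    (ascPochhammer_eval_succ_left (1 / 2) m)
  rw [show (1 / 2 + 1 : ℝ) = 3 / 2 by norm_num] at e2
  rw [Nat.factorial_succ]
  push_cast
  rw [factorial_two_mul_eq]
  linear_combination 2 * 4 ^ m * (m.factorial : ℝ) * e2

/-- Termwise integration of `s ^ (p - 1) * exp (-s² - 2xs)` in powers of `x` gives this series;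
its even and odd parts are the two Kummer series of the Hermite function. -/
theorem hasSum_hermite_series {p : ℝ} (hp : 0 < p) (x : ℝ) :
    HasSum (fun k : ℕ ↦ (-2 * x) ^ k / k.factorial * (1 / 2 * Real.Gamma ((p + k) / 2)))
      (Real.Gamma p * hermiteFn (-p) x) := by
  have he := (hasSum_kummerM (p / 2) (q := 1 / 2) (by norm_num) (x ^ 2)).mul_left
    (1 / 2 * Real.Gamma (p / 2))
  have ho := (hasSum_kummerM ((p + 1) / 2) (q := 3 / 2) (by norm_num) (x ^ 2)).mul_left
    (-x * Real.Gamma ((p + 1) / 2))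
  have hdup : Real.Gamma (p / 2) * Real.Gamma ((p + 1) / 2) =
      Real.Gamma p * (2 * 2 ^ (-p)) * √Real.pi := by
    have := Real.Gamma_mul_Gamma_add_half (p / 2)
    rw [show p / 2 + 1 / 2 = (p + 1) / 2 by ring, show 2 * (p / 2) = p by ring,
      sub_eq_add_neg, Real.rpow_add two_pos, Real.rpow_one] at this
    exact this
  have g1 : 0 < Real.Gamma (p / 2) := Real.Gamma_pos_of_pos (by positivity)
  have g2 : 0 < Real.Gamma ((p + 1) / 2) := Real.Gamma_pos_of_pos (by positivity)
  have hval : Real.Gamma p * hermiteFn (-p) x =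
      1 / 2 * Real.Gamma (p / 2) * kummerM (p / 2) (1 / 2) (x ^ 2) +
        -x * Real.Gamma ((p + 1) / 2) * kummerM ((p + 1) / 2) (3 / 2) (x ^ 2) := by
    unfold hermiteFn
    rw [neg_neg, show (1 - -p) / 2 = (p + 1) / 2 by ring]
    field_simp
    linear_combination (-1 : ℝ) * (kummerM (p / 2) (1 / 2) (x ^ 2) * Real.Gamma (p / 2) -
      2 * x * kummerM ((p + 1) / 2) (3 / 2) (x ^ 2) * Real.Gamma ((p + 1) / 2)) * hdup
  rw [hval]
  refine HasSum.even_add_odd (he.congr_fun fun m ↦ ?_) (ho.congr_fun fun m ↦ ?_)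
  · have h1 := ascPochhammer_eval_pos (q := 1 / 2) (by norm_num) m
    have h2 := Gamma_add_natCast_eq (p := p / 2) (by positivity) m
    rw [show (p + (2 * m : ℕ)) / 2 = p / 2 + m by push_cast; ring, h2, factorial_two_mul_eq,
      pow_mul, show (-2 * x) ^ 2 = 4 * x ^ 2 by ring, mul_pow]
    field_simp
  · have h1 := ascPochhammer_eval_pos (q := 3 / 2) (by norm_num) m
    have h2 := Gamma_add_natCast_eq (p := (p + 1) / 2) (by positivity) m
    rw [show (p + (2 * m + 1 : ℕ)) / 2 = (p + 1) / 2 + m by push_cast; ring, h2,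
      factorial_two_mul_add_one_eq, pow_succ,
      pow_mul, show (-2 * x) ^ 2 = 4 * x ^ 2 by ring, mul_pow]
    field_simp

theorem integral_rpow_mul_exp_neg_sq {q : ℝ} (hq : -1 < q) :
    ∫ s in Ioi (0 : ℝ), s ^ q * Real.exp (-s ^ 2) = 1 / 2 * Real.Gamma ((q + 1) / 2) := by
  simpa using integral_rpow_mul_exp_neg_rpow (p := 2) two_pos hq

/-- The integral representation of the Hermite function of degree `-p < 0`. -/
theorem integral_rpow_mul_exp_eq_hermiteFn {p : ℝ} (hp : 0 < p) (x : ℝ) :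
    ∫ s in Ioi (0 : ℝ), s ^ (p - 1) * Real.exp (-s ^ 2 - 2 * x * s) =
      Real.Gamma p * hermiteFn (-p) x := by
  have hq (k : ℕ) : -1 < p - 1 + k := by have : (0 : ℝ) ≤ k := by positivity
                                         linarith
  have hint (k : ℕ) (y : ℝ) : ∫ s in Ioi (0 : ℝ),
      y ^ k / k.factorial * (s ^ (p - 1 + k) * Real.exp (-s ^ 2)) =
        y ^ k / k.factorial * (1 / 2 * Real.Gamma ((p + k) / 2)) := by
    rw [integral_const_mul, integral_rpow_mul_exp_neg_sq (hq k)]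
    ring_nf
  have key := hasSum_integral_of_summable_integral_norm (μ := volume.restrict (Ioi (0 : ℝ)))
    (F := fun (k : ℕ) (s : ℝ) ↦
      (-2 * x) ^ k / k.factorial * (s ^ (p - 1 + k) * Real.exp (-s ^ 2)))
    (fun k ↦ ?_) ?_
  · simp only [hint] at key
    rw [(hasSum_hermite_series hp x).unique key]
    refine setIntegral_congr_fun measurableSet_Ioi fun s (hs : 0 < s) ↦ ?_
    have hexp : HasSum (fun k : ℕ ↦ (-2 * x * s) ^ k / k.factorial)
        (Real.exp (-2 * x * s)) := by
      rw [Real.exp_eq_exp_ℝ]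
      exact NormedSpace.expSeries_div_hasSum_exp _
    have h2 := (hexp.mul_left (s ^ (p - 1) * Real.exp (-s ^ 2))).tsum_eq
    rw [mul_assoc (s ^ (p - 1)), ← Real.exp_add] at h2
    rw [show -s ^ 2 - 2 * x * s = -s ^ 2 + -2 * x * s by ring, ← h2]
    refine tsum_congr fun k ↦ ?_
    rw [Real.rpow_add hs, Real.rpow_natCast, mul_pow]
    ring
  · have := integrableOn_rpow_mul_exp_neg_mul_sq one_pos (hq k)
    simp only [neg_mul, one_mul] at this
    exact this.const_mul _
  -- the integrals of the norms are the terms of the same series at `-|x|`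
  · refine (hasSum_hermite_series hp (-|x|)).summable.congr fun k ↦ ?_
    rw [← hint k]
    refine setIntegral_congr_fun measurableSet_Ioi fun s (hs : 0 < s) ↦ ?_
    have h1 : 0 < s ^ (p - 1 + k) := by positivity
    rw [Real.norm_eq_abs, abs_mul, abs_div, abs_pow, abs_mul, abs_neg, abs_two, Nat.abs_cast,
      abs_of_pos (mul_pos h1 (Real.exp_pos _)), neg_mul_neg]

theorem integrableOn_rpow_mul_exp_neg_mul {q r : ℝ} (hq : -1 < q) (hr : 0 < r) :
    IntegrableOn (fun s : ℝ ↦ s ^ q * Real.exp (-(r * s))) (Ioi 0) := by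
  simpa using integrableOn_rpow_mul_exp_neg_mul_rpow hq one_pos hr

/-- At a negative argument the falling factorials are, up to sign, quotients of Gamma values. -/
theorem charlier_neg {a p : ℝ} (hp : 0 < p) (n : ℕ) :
    Real.Gamma p * charlier a n (-p) = ∑ k ∈ Finset.range (n + 1),
      (n.choose k : ℝ) * (a ^ k)⁻¹ * Real.Gamma (p + k) := by
  have h (k : ℕ) : ∏ j ∈ Finset.range k, (-p - (j : ℝ)) =
      (-1) ^ k * (ascPochhammer ℝ k).eval p := by
    induction k with
    | zero => simp
    | succ k ih => rw [Finset.prod_range_succ, ih, ascPochhammer_succ_eval]; ring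
  rw [charlier_eq_sum_prod, Finset.mul_sum]
  refine Finset.sum_congr rfl fun k _ ↦ ?_
  rw [Gamma_add_natCast_eq hp, h, neg_pow a, mul_inv, ← inv_pow, inv_neg_one]
  have h1 : (-1 : ℝ) ^ k * (-1) ^ k = 1 := by rw [← mul_pow]; norm_num
  linear_combination (n.choose k : ℝ) * (a ^ k)⁻¹ * (ascPochhammer ℝ k).eval p *
    Real.Gamma p * h1

/-- The integral representation of the Charlier polynomials at a negative argument `-p`. -/
theorem integral_rpow_mul_exp_mul_pow_eq_charlier {a p r : ℝ} (hp : 0 < p) (hr : 0 < r) (n : ℕ) :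
    ∫ s in Ioi (0 : ℝ), s ^ (p - 1) * (Real.exp (-(r * s)) * (1 + r * s / a) ^ n) =
      Real.Gamma p * (r ^ (-p) * charlier a n (-p)) := by
  have hq (k : ℕ) : -1 < p + k - 1 := by have : (0 : ℝ) ≤ k := by positivity
                                         linarith
  have h1 : ∫ s in Ioi (0 : ℝ), s ^ (p - 1) * (Real.exp (-(r * s)) * (1 + r * s / a) ^ n) =
      ∫ s in Ioi (0 : ℝ), ∑ k ∈ Finset.range (n + 1), (n.choose k : ℝ) * (r ^ k * (a ^ k)⁻¹) *
        (s ^ (p + k - 1) * Real.exp (-(r * s))) := by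
    refine setIntegral_congr_fun measurableSet_Ioi fun s (hs : 0 < s) ↦ ?_
    rw [add_comm, add_pow, Finset.mul_sum, Finset.mul_sum]
    refine Finset.sum_congr rfl fun k _ ↦ ?_
    rw [show p + k - 1 = p - 1 + k by ring, Real.rpow_add hs, Real.rpow_natCast, div_pow, mul_pow]
    ring
  rw [h1, integral_finsetSum _
    fun k _ ↦ (integrableOn_rpow_mul_exp_neg_mul (hq k) hr).const_mul _]
  rw [mul_left_comm, charlier_neg hp, Finset.mul_sum]
  refine Finset.sum_congr rfl fun k _ ↦ ?_
  rw [integral_const_mul, Real.integral_rpow_mul_exp_neg_mul_Ioi (by positivity) hr, one_div,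
    Real.inv_rpow hr.le, Real.rpow_add hr, Real.rpow_neg hr.le, Real.rpow_natCast]
  field_simp

/-! ### The bound for negative degree -/

/-- This is `log y ≤ sinh (log y)` at `y = 1 + u`. -/
theorem log_one_add_le_sub {u : ℝ} (hu : 0 ≤ u) :
    Real.log (1 + u) ≤ u - u ^ 2 / (2 * (1 + u)) := by
  have h1 : 0 < 1 + u := by linarith
  have h := Real.self_le_sinh_iff.mpr (Real.log_nonneg (by linarith : 1 ≤ 1 + u))
  rw [Real.sinh_log h1] at h
  refine h.trans_eq ?_
  field_simp
  ring

theorem log_one_add_le_cubic {u : ℝ} (hu : 0 ≤ u) :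
    Real.log (1 + u) ≤ u - u ^ 2 / 2 + u ^ 3 / 2 := by
  refine (log_one_add_le_sub hu).trans ?_
  have h1 : 0 < 1 + u := by linarith
  have h2 : u - u ^ 2 / 2 + u ^ 3 / 2 - (u - u ^ 2 / (2 * (1 + u))) =
      u ^ 4 / (2 * (1 + u)) := by field_simp; ring
  have h3 : 0 ≤ u ^ 4 / (2 * (1 + u)) := by positivity
  linarith

theorem sub_sq_div_two_le_log_one_add {u : ℝ} (hu : 0 ≤ u) :
    u - u ^ 2 / 2 ≤ Real.log (1 + u) := by
  refine le_trans ?_ (Real.le_log_one_add_of_nonneg hu)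
  rw [le_div_iff₀ (by linarith)]
  nlinarith [pow_nonneg hu 3]

theorem abs_exp_sub_exp_le {f g M : ℝ} (hf : f ≤ M) (hg : g ≤ M) :
    |Real.exp f - Real.exp g| ≤ |f - g| * Real.exp M := by
  have key {f g : ℝ} (hf : f ≤ M) (hgf : g ≤ f) :
      |Real.exp f - Real.exp g| ≤ |f - g| * Real.exp M := by
    rw [abs_of_nonneg (sub_nonneg.mpr (Real.exp_le_exp.mpr hgf)),
      abs_of_nonneg (sub_nonneg.mpr hgf)]
    have h1 := Real.add_one_le_exp (g - f)
    have h2 : Real.exp g = Real.exp f * Real.exp (g - f) := by rw [← Real.exp_add]; ring_nf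
    calc Real.exp f - Real.exp g ≤ (f - g) * Real.exp f := by
          rw [h2]; nlinarith [Real.exp_pos f]
      _ ≤ (f - g) * Real.exp M :=
          mul_le_mul_of_nonneg_left (Real.exp_le_exp.mpr hf) (sub_nonneg.mpr hgf)
  rcases le_total g f with h | h
  · exact key hf h
  · rw [abs_sub_comm, abs_sub_comm f]
    exact key hg h

/-- The logarithms of the two integrands, `(a - xr + θ) log (1 + δs) - rs` and `-s² - 2xs` with
`r = √(2a)` and `δ = r / a`, differ by `O(δ)`, with a polynomial factor in `s`. -/
theorem abs_log_integrand_sub_le {a r X x θ s : ℝ} (ha : 0 < a) (hr : 0 < r) (hra : r ^ 2 = 2 * a)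
    (hx : |x| ≤ X) (hθ₀ : 0 ≤ θ) (hθ₁ : θ ≤ 1) (hs : 0 ≤ s) :
    |(a - x * r + θ) * Real.log (1 + r * s / a) - r * s - (-s ^ 2 - 2 * x * s)| ≤
      r / a * (s ^ 3 + X * s ^ 2 + s) := by
  obtain ⟨u, hu⟩ : ∃ u, u = r * s / a := ⟨_, rfl⟩
  have hu0 : 0 ≤ u := by rw [hu]; positivity
  rw [← hu]
  have l1 := log_one_add_le_cubic hu0
  have l2 := sub_sq_div_two_le_log_one_add hu0
  have l0 : 0 ≤ Real.log (1 + u) := Real.log_nonneg (by linarith)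
  have l3 : Real.log (1 + u) ≤ u := by
    have := Real.log_le_sub_one_of_pos (by linarith : 0 < 1 + u)
    linarith
  have i1 : a * u = r * s := by rw [hu]; field_simp
  have hrs : r * u = 2 * s := by
    rw [hu]; field_simp; linear_combination s * hra
  have hus : u = r / a * s := by rw [hu]; ring
  generalize Real.log (1 + u) = l at *
  have e : (a - x * r + θ) * l - r * s - (-s ^ 2 - 2 * x * s) =
      a * (l - u + u ^ 2 / 2) + x * r * (u - l) + θ * l := by
    have i2 : a * u ^ 2 = 2 * s ^ 2 := by
      linear_combination u * i1 + s * hrs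
    linear_combination i1 - i2 / 2 - x * hrs
  have b1 : |a * (l - u + u ^ 2 / 2)| ≤ r / a * s ^ 3 := by
    rw [abs_of_nonneg (mul_nonneg ha.le (by linarith))]
    have h3 : a * (u ^ 3 / 2) = r / a * s ^ 3 := by
      linear_combination u ^ 2 / 2 * i1 + s * u / 2 * hrs + s ^ 2 * hus
    rw [← h3]
    exact mul_le_mul_of_nonneg_left (by linarith) ha.le
  have b2 : |x * r * (u - l)| ≤ r / a * (X * s ^ 2) := by
    rw [abs_mul, abs_mul, abs_of_pos hr, abs_of_nonneg (sub_nonneg.mpr l3)]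
    have h3 : X * (r * (u ^ 2 / 2)) = r / a * (X * s ^ 2) := by
      linear_combination X * u / 2 * hrs + X * s * hus
    rw [← h3, mul_assoc]
    have h4 : r * (u - l) ≤ r * (u ^ 2 / 2) := mul_le_mul_of_nonneg_left (by linarith) hr.le
    exact mul_le_mul hx h4 (mul_nonneg hr.le (sub_nonneg.mpr l3)) ((abs_nonneg x).trans hx)
  have b3 : |θ * l| ≤ r / a * s := by
    rw [abs_of_nonneg (mul_nonneg hθ₀ l0), ← hus]
    nlinarith
  rw [e]
  exact (abs_add_three _ _ _).trans ((add_le_add (add_le_add b1 b2) b3).trans_eq (by ring))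

/-- Exponential domination of the Charlier integrand, uniform in large `a`: the exponent is at
most `-s² / (1 + δs) + (2X + 1)s`, and `s² / (1 + δs) ≥ Λs - Λ² / 2` as soon as `2Λδ ≤ 1`. -/
theorem log_charlier_integrand_le {a r X x θ s : ℝ} (ha : 0 < a) (hr : 0 < r)
    (hra : r ^ 2 = 2 * a) (hx : |x| ≤ X) (hθ₀ : 0 ≤ θ) (hθ₁ : θ ≤ 1) (hs : 0 ≤ s)
    (hδ : r / a * (2 * (2 * X + 2)) ≤ 1) :
    (a - x * r + θ) * Real.log (1 + r * s / a) - r * s ≤ (2 * X + 2) ^ 2 / 2 - s := by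
  have hX : 0 ≤ X := (abs_nonneg x).trans hx
  obtain ⟨δ, hδe⟩ : ∃ δ, δ = r / a := ⟨_, rfl⟩
  have hus : r * s / a = δ * s := by rw [hδe]; ring
  rw [hus]
  rw [← hδe] at hδ
  have hδ0 : 0 < δ := by rw [hδe]; positivity
  have hδ1 : δ ≤ 1 := by nlinarith
  have hδs : 0 ≤ δ * s := by positivity
  have l1 := log_one_add_le_sub hδs
  have l0 : 0 ≤ Real.log (1 + δ * s) := Real.log_nonneg (by linarith)
  have l3 : Real.log (1 + δ * s) ≤ δ * s := by
    have := Real.log_le_sub_one_of_pos (by linarith : 0 < 1 + δ * s)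
    linarith
  have i1 : a * δ = r := by rw [hδe]; field_simp
  have i2 : r * δ = 2 := by rw [hδe]; field_simp; linear_combination hra
  generalize Real.log (1 + δ * s) = l at *
  have b1 : a * l ≤ r * s - s ^ 2 / (1 + δ * s) := by
    refine (mul_le_mul_of_nonneg_left l1 ha.le).trans_eq ?_
    have h1 : 1 + δ * s ≠ 0 := by positivity
    field_simp
    linear_combination (2 * (1 + δ * s) * s - δ * s ^ 2) * i1 - s ^ 2 * i2
  have b2 : -(x * r) * l ≤ 2 * X * s := by
    have h1 : -(x * r) * l ≤ X * r * l := by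
      have := neg_le_of_abs_le hx
      have : 0 ≤ r * l := mul_nonneg hr.le l0
      nlinarith
    have h2 : X * r * l ≤ X * r * (δ * s) := mul_le_mul_of_nonneg_left l3 (by positivity)
    have h3 : X * r * (δ * s) = 2 * X * s := by linear_combination X * s * i2
    linarith
  have b3 : θ * l ≤ s := by nlinarith
  have b4 : (2 * X + 2) * s - (2 * X + 2) ^ 2 / 2 ≤ s ^ 2 / (1 + δ * s) := by
    rw [le_div_iff₀ (by positivity)]
    have h1 : 0 ≤ (2 * X + 2) ^ 2 / 2 * (δ * s) := by positivity
    have h2 : δ * (2 * (2 * X + 2)) * s ^ 2 ≤ 1 * s ^ 2 :=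
      mul_le_mul_of_nonneg_right hδ (sq_nonneg s)
    nlinarith [sq_nonneg (s - (2 * X + 2))]
  linarith

/-- Exponential domination of the Hermite integrand, with the same constant as for the Charlier
integrand. -/
theorem neg_sq_sub_le {X x s : ℝ} (hx : |x| ≤ X) (hs : 0 ≤ s) :
    -s ^ 2 - 2 * x * s ≤ (2 * X + 2) ^ 2 / 2 - s := by
  have h1 := neg_le_of_abs_le hx
  have h2 : -x * s ≤ X * s := mul_le_mul_of_nonneg_right (by linarith) hs
  nlinarith [sq_nonneg (s - (2 * X + 1)), abs_nonneg x]

theorem aestronglyMeasurable_rpow_mul {q : ℝ} {h : ℝ → ℝ} (hh : Continuous h) :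
    AEStronglyMeasurable (fun s : ℝ ↦ s ^ q * h s) (volume.restrict (Ioi 0)) :=
  (by fun_prop : Measurable fun s : ℝ ↦ s ^ q * h s).aestronglyMeasurable

theorem integrableOn_rpow_mul_of_le_exp {p C : ℝ} (hp : 0 < p) {h : ℝ → ℝ} (hh : Continuous h)
    (hb : ∀ s, 0 < s → |h s| ≤ C * Real.exp (-s)) :
    IntegrableOn (fun s : ℝ ↦ s ^ (p - 1) * h s) (Ioi 0) := by
  have hi := (integrableOn_rpow_mul_exp_neg_mul (q := p - 1) (by linarith) one_pos).const_mul C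
  refine hi.mono' (aestronglyMeasurable_rpow_mul hh) ?_
  refine (ae_restrict_iff' measurableSet_Ioi).mpr (Filter.Eventually.of_forall fun s hs ↦ ?_)
  have hs' : 0 < s := hs
  have h1 : 0 < s ^ (p - 1) := Real.rpow_pos_of_pos hs' _
  rw [Real.norm_eq_abs, abs_mul, abs_of_pos h1, one_mul]
  nlinarith [hb s hs']

theorem integral_rpow_mul_exp_neg {p : ℝ} (hp : 0 < p) :
    ∫ s in Ioi (0 : ℝ), s ^ (p - 1) * Real.exp (-s) = Real.Gamma p := by
  simpa using Real.integral_rpow_mul_exp_neg_mul_Ioi hp one_pos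

theorem abs_hermiteFn_neg_le {X x p : ℝ} (hx : |x| ≤ X) (hp : 0 < p) :
    |hermiteFn (-p) x| ≤ Real.exp ((2 * X + 2) ^ 2 / 2) := by
  have hG := Real.Gamma_pos_of_pos hp
  have h := norm_integral_le_of_norm_le (μ := volume.restrict (Ioi (0 : ℝ)))
    (f := fun s ↦ s ^ (p - 1) * Real.exp (-s ^ 2 - 2 * x * s))
    ((integrableOn_rpow_mul_exp_neg_mul (q := p - 1) (by linarith) one_pos).const_mul
      (Real.exp ((2 * X + 2) ^ 2 / 2)))
    ((ae_restrict_iff' measurableSet_Ioi).mpr (Filter.Eventually.of_forall fun s hs ↦ ?_))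
  · simp only [one_mul] at h
    rw [integral_rpow_mul_exp_eq_hermiteFn hp, integral_const_mul, integral_rpow_mul_exp_neg hp,
      Real.norm_eq_abs, abs_mul, abs_of_pos hG, mul_comm] at h
    exact le_of_mul_le_mul_right h hG
  · have hs' : 0 < s := hs
    rw [Real.norm_eq_abs, abs_of_nonneg (by positivity), mul_left_comm, ← Real.exp_add]
    refine mul_le_mul_of_nonneg_left (Real.exp_le_exp.mpr ?_) (by positivity)
    have := neg_sq_sub_le hx hs'.le
    linarith

/-- The estimate in degree `-p < 0`: the polynomial in `p` is what remains of
`Γ(p + 3) + X Γ(p + 2) + Γ(p + 1)` after division by `Γ(p)`. -/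
theorem abs_scaledCharlier_sub_hermiteFn_neg_le {a X x p : ℝ} (ha : 0 < a) (hx : |x| ≤ X)
    (hp : 0 < p) (hδ : √(2 * a) / a * (2 * (2 * X + 2)) ≤ 1) (ht : 0 ≤ a - x * √(2 * a)) :
    |scaledCharlier a x (-p) - hermiteFn (-p) x| ≤
      √(2 * a) / a * (Real.exp ((2 * X + 2) ^ 2 / 2) *
        (p * (p + 1) * (p + 2) + X * (p * (p + 1)) + p)) := by
  have hG := Real.Gamma_pos_of_pos hp
  have hX : 0 ≤ X := (abs_nonneg x).trans hx
  obtain ⟨r, hr⟩ : ∃ r, r = √(2 * a) := ⟨_, rfl⟩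
  have hr0 : 0 < r := by rw [hr]; positivity
  have hra : r ^ 2 = 2 * a := by rw [hr]; exact Real.sq_sqrt (by positivity)
  obtain ⟨n, hn⟩ : ∃ n, n = ⌈a - x * √(2 * a)⌉₊ := ⟨_, rfl⟩
  obtain ⟨θ, hθ⟩ : ∃ θ, θ = n - (a - x * r) := ⟨_, rfl⟩
  have hθ0 : 0 ≤ θ := by
    rw [hθ, hn, hr]; exact sub_nonneg.mpr (Nat.le_ceil _)
  have hθ1 : θ ≤ 1 := by
    rw [hθ, hn, hr]; have := Nat.ceil_lt_add_one ht; linarith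
  have hnθ : (n : ℝ) = a - x * r + θ := by rw [hθ]; ring
  have hy : scaledCharlier a x (-p) = r ^ (-p) * charlier a n (-p) := by
    unfold scaledCharlier
    rw [← hn, hr, Real.sqrt_eq_rpow, ← Real.rpow_mul (by positivity)]
    ring_nf
  rw [hy]
  rw [← hr] at hδ ht ⊢
  obtain ⟨K, hK⟩ : ∃ K, K = (2 * X + 2) ^ 2 / 2 := ⟨_, rfl⟩
  -- the Charlier integrand in exponential form
  have hF {s : ℝ} (hs : 0 < s) : Real.exp (-(r * s)) * (1 + r * s / a) ^ n =
      Real.exp ((a - x * r + θ) * Real.log (1 + r * s / a) - r * s) := by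
    have h1 : 0 < 1 + r * s / a := by positivity
    rw [← hnθ, sub_eq_add_neg, Real.exp_add, mul_comm (n : ℝ), ← Real.rpow_def_of_pos h1,
      Real.rpow_natCast, mul_comm]
  have bF {s : ℝ} (hs : 0 < s) := log_charlier_integrand_le ha hr0 hra hx hθ0 hθ1 hs.le hδ
  have bG {s : ℝ} (hs : 0 < s) := neg_sq_sub_le hx hs.le
  rw [← hK] at *
  have iF : IntegrableOn (fun s ↦ s ^ (p - 1) *
      (Real.exp (-(r * s)) * (1 + r * s / a) ^ n)) (Ioi 0) := by
    refine integrableOn_rpow_mul_of_le_exp (C := Real.exp K) hp (by fun_prop) fun s hs ↦ ?_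
    rw [hF hs, Real.abs_exp, ← Real.exp_add]
    exact Real.exp_le_exp.mpr (by linarith [bF hs])
  have iG : IntegrableOn (fun s ↦ s ^ (p - 1) * Real.exp (-s ^ 2 - 2 * x * s)) (Ioi 0) := by
    refine integrableOn_rpow_mul_of_le_exp (C := Real.exp K) hp (by fun_prop) fun s hs ↦ ?_
    rw [Real.abs_exp, ← Real.exp_add]
    exact Real.exp_le_exp.mpr (by linarith [bG hs])
  have hi (q : ℝ) (hq : 0 < q) : IntegrableOn (fun s ↦ s ^ (q - 1) * Real.exp (-s)) (Ioi 0) := by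
    simpa using integrableOn_rpow_mul_exp_neg_mul (q := q - 1) (by linarith) one_pos
  have h := norm_integral_le_of_norm_le (μ := volume.restrict (Ioi (0 : ℝ)))
    (f := fun s ↦ s ^ (p - 1) * (Real.exp (-(r * s)) * (1 + r * s / a) ^ n) -
      s ^ (p - 1) * Real.exp (-s ^ 2 - 2 * x * s))
    (((((hi (p + 1 + 1 + 1) (by positivity)).add
      ((hi (p + 1 + 1) (by positivity)).const_mul X)).add
      (hi (p + 1) (by positivity))).const_mul (r / a * Real.exp K)))
    ((ae_restrict_iff' measurableSet_Ioi).mpr (Filter.Eventually.of_forall fun s hs ↦ ?_))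
  · rw [integral_sub iF iG, integral_rpow_mul_exp_eq_hermiteFn hp,
      integral_rpow_mul_exp_mul_pow_eq_charlier hp hr0, integral_const_mul] at h
    simp only [Pi.add_apply] at h
    rw [integral_add, integral_add, integral_const_mul, integral_rpow_mul_exp_neg (by positivity),
      integral_rpow_mul_exp_neg (by positivity), integral_rpow_mul_exp_neg (by positivity),
      Real.Gamma_add_one (by positivity), Real.Gamma_add_one (by positivity),
      Real.Gamma_add_one (by positivity), ← mul_sub, Real.norm_eq_abs, abs_mul,
      abs_of_pos hG] at h
    · refine le_of_mul_le_mul_left (h.trans_eq ?_) hG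
      ring
    · exact hi _ (by positivity)
    · exact (hi _ (by positivity)).const_mul X
    · exact (hi _ (by positivity)).add ((hi _ (by positivity)).const_mul X)
    · exact hi _ (by positivity)
  · have hs' : 0 < s := hs
    have h1 : 0 < s ^ (p - 1) := Real.rpow_pos_of_pos hs' _
    have e1 : s ^ (p + 1 - 1) = s ^ (p - 1) * s := by
      rw [← Real.rpow_add_one hs'.ne']; ring_nf
    have e2 : s ^ (p + 1 + 1 - 1) = s ^ (p - 1) * s ^ 2 := by
      rw [← Real.rpow_add_natCast hs'.ne']; norm_num; ring_nf
    have e3 : s ^ (p + 1 + 1 + 1 - 1) = s ^ (p - 1) * s ^ 3 := by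
      rw [← Real.rpow_add_natCast hs'.ne']; norm_num; ring_nf
    have h2 := abs_exp_sub_exp_le (bF hs') (bG hs')
    have h3 := abs_log_integrand_sub_le ha hr0 hra hx hθ0 hθ1 hs'.le
    have h4 : Real.exp (K - s) = Real.exp K * Real.exp (-s) := by
      rw [← Real.exp_add, sub_eq_add_neg]
    rw [← mul_sub, Real.norm_eq_abs, abs_mul, abs_of_pos h1, hF hs']
    refine (mul_le_mul_of_nonneg_left (h2.trans (mul_le_mul_of_nonneg_right h3
      (Real.exp_pos _).le)) h1.le).trans_eq ?_
    simp only [Pi.add_apply]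
    rw [e1, e2, e3, h4]
    ring

end NegativeDegree

/-! ### The uniform bound -/

theorem sqrt_two_mul_div_self (a : ℝ) : √(2 * a) / a = √2 / √a := by
  rw [Real.sqrt_mul zero_le_two, mul_div_assoc, Real.sqrt_div_self']
  ring

/-- The leading coefficient of the Charlier recurrence tends to that of the Hermite recurrence at
the rate `1 / √a`; the rounding in `⌈a - x√(2a)⌉₊` contributes the summand `1`. -/
theorem abs_forward_coeff_sub_le {a x ν : ℝ} (ha : 0 < a) (ht : 0 ≤ a - x * √(2 * a)) :
    |√(2 * a) / a * (ν + a - ⌈a - x * √(2 * a)⌉₊) - 2 * x| ≤ 2 * (|ν| + 1) / √a := by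
  have hsa : 0 < √a := Real.sqrt_pos.mpr ha
  have h1 := Nat.le_ceil (a - x * √(2 * a))
  have h2 := Nat.ceil_lt_add_one ht
  obtain ⟨n, hn⟩ : ∃ n : ℝ, n = ⌈a - x * √(2 * a)⌉₊ := ⟨_, rfl⟩
  rw [← hn] at h1 h2 ⊢
  have hr2 : √2 / √a * √(2 * a) = 2 := by
    rw [Real.sqrt_mul zero_le_two]
    field_simp
    exact Real.sq_sqrt zero_le_two
  have e : √(2 * a) / a * (ν + a - n) - 2 * x =
      √2 / √a * (ν - (n - (a - x * √(2 * a)))) := by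
    rw [sqrt_two_mul_div_self]
    linear_combination x * hr2
  have h3 : √2 ≤ 2 := by rw [Real.sqrt_le_left (by norm_num)]; norm_num
  have h4 : |ν - (n - (a - x * √(2 * a)))| ≤ |ν| + 1 :=
    (abs_sub _ _).trans (add_le_add_right (abs_le.mpr ⟨by linarith, by linarith⟩) _)
  rw [e, abs_mul, abs_of_nonneg (by positivity : 0 ≤ √2 / √a), mul_div_right_comm]
  gcongr

/-- For `a ≥ 8Λ²` with `Λ = 2X + 2`, the step `δ = √(2a) / a` satisfies `2Λδ ≤ 1`, and
`a - x√(2a)` is nonnegative. -/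
theorem conditions_of_le {a X x : ℝ} (ha : 8 * (2 * X + 2) ^ 2 ≤ a) (hx : |x| ≤ X) :
    1 ≤ a ∧ √(2 * a) / a * (2 * (2 * X + 2)) ≤ 1 ∧ 0 ≤ a - x * √(2 * a) := by
  have hX : 0 ≤ X := (abs_nonneg x).trans hx
  have ha1 : 1 ≤ a := by nlinarith
  have hsa : 0 < √a := Real.sqrt_pos.mpr (by linarith)
  have h : √2 * (2 * (2 * X + 2)) ≤ √a := by
    refine Real.le_sqrt_of_sq_le (le_trans (le_of_eq ?_) ha)
    rw [mul_pow, Real.sq_sqrt zero_le_two]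
    ring
  refine ⟨ha1, ?_, ?_⟩
  · rw [sqrt_two_mul_div_self, div_mul_eq_mul_div, div_le_one hsa]
    exact h
  · have h1 : x * √(2 * a) ≤ X * √(2 * a) :=
      mul_le_mul_of_nonneg_right ((le_abs_self x).trans hx) (Real.sqrt_nonneg _)
    have h2 : √2 * X ≤ √a := by
      refine le_trans (mul_le_mul_of_nonneg_left ?_ (Real.sqrt_nonneg 2)) h
      linarith
    have h3 : X * √(2 * a) ≤ √a * √a := by
      rw [Real.sqrt_mul zero_le_two, ← mul_assoc, mul_comm X]
      exact mul_le_mul_of_nonneg_right h2 hsa.le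
    rw [Real.mul_self_sqrt (by linarith)] at h3
    linarith

theorem exists_bound_of_neg {X A : ℝ} (hX : 0 ≤ X) :
    ∃ C B : ℝ, ∀ a : ℝ, 8 * (2 * X + 2) ^ 2 ≤ a → ∀ x ν : ℝ, |x| ≤ X → -A ≤ ν → ν < 0 →
      |scaledCharlier a x ν - hermiteFn ν x| ≤ C / √a ∧ |hermiteFn ν x| ≤ B := by
  refine ⟨√2 * (Real.exp ((2 * X + 2) ^ 2 / 2) *
      (A * (A + 1) * (A + 2) + X * (A * (A + 1)) + A)),
    Real.exp ((2 * X + 2) ^ 2 / 2), fun a ha x ν hx hA hν ↦ ?_⟩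
  obtain ⟨ha1, hδ, ht⟩ := conditions_of_le ha hx
  have hp : 0 < -ν := by linarith
  have hpA : -ν ≤ A := by linarith
  have h1 := abs_hermiteFn_neg_le hx hp
  have h2 := abs_scaledCharlier_sub_hermiteFn_neg_le (by linarith) hx hp hδ ht
  have hA0 : 0 < A := hp.trans_le hpA
  generalize hpe : -ν = p at *
  obtain rfl : ν = -p := by linarith
  refine ⟨h2.trans ?_, h1⟩
  rw [sqrt_two_mul_div_self, div_mul_eq_mul_div]
  gcongr

/-- The error estimate and the boundedness of the Hermite function on `[-A, N)`, by upward
induction on `N` along the three-term recurrences. -/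
theorem exists_bound_of_lt_nat {X A : ℝ} (hX : 0 ≤ X) (hA : 2 ≤ A) (N : ℕ) :
    ∃ C B : ℝ, ∀ a : ℝ, 8 * (2 * X + 2) ^ 2 ≤ a → ∀ x ν : ℝ, |x| ≤ X → -A ≤ ν → ν < N →
      |scaledCharlier a x ν - hermiteFn ν x| ≤ C / √a ∧ |hermiteFn ν x| ≤ B := by
  induction N with
  | zero => simpa using exists_bound_of_neg hX
  | succ N ih =>
    obtain ⟨C, B, h⟩ := ih
    obtain ⟨C₁, hC, hC₁⟩ : ∃ C₁, C ≤ C₁ ∧ 0 ≤ C₁ := ⟨max C 0, le_max_left _ _, le_max_right _ _⟩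
    obtain ⟨B₁, hB, hB₁⟩ : ∃ B₁, B ≤ B₁ ∧ 0 ≤ B₁ := ⟨max B 0, le_max_left _ _, le_max_right _ _⟩
    refine ⟨C₁ + (2 * (N + 2) * (B₁ + C₁) + 2 * X * C₁ + 2 * (N + 1) * C₁),
      B₁ + (2 * X * B₁ + 2 * (N + 1) * B₁), fun a ha x ν hx hAν hν ↦ ?_⟩
    obtain ⟨ha1, -, ht⟩ := conditions_of_le ha hx
    have ha0 : 0 < a := by linarith
    have hsa : 1 ≤ √a := Real.one_le_sqrt.mpr ha1
    have hN : (0 : ℝ) ≤ N := N.cast_nonneg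
    rcases lt_or_ge ν N with hνN | hνN
    · obtain ⟨h1, h2⟩ := h a ha x ν hx hAν hνN
      refine ⟨h1.trans ?_, h2.trans (hB.trans (le_add_of_nonneg_right (by positivity)))⟩
      exact div_le_div_of_nonneg_right (hC.trans (le_add_of_nonneg_right (by positivity)))
        (by positivity)
    · obtain ⟨μ, rfl⟩ : ∃ μ, ν = μ + 1 := ⟨ν - 1, by ring⟩
      push_cast at hν
      obtain ⟨e1, b1⟩ := h a ha x μ hx (by linarith) (by linarith)
      obtain ⟨e2, b2⟩ := h a ha x (μ - 1) hx (by linarith) (by linarith)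
      have hμ : |μ| ≤ N + 1 := abs_le.mpr ⟨by linarith, by linarith⟩
      have hc := abs_forward_coeff_sub_le (ν := μ) ha0 ht
      have hy : |scaledCharlier a x μ| ≤ B₁ + C₁ := by
        have h1 : C / √a ≤ C₁ := div_le_of_le_mul₀ (by positivity) hC₁ (by nlinarith)
        have h2 := abs_add_le (scaledCharlier a x μ - hermiteFn μ x) (hermiteFn μ x)
        rw [sub_add_cancel] at h2
        linarith
      replace e1 := e1.trans (div_le_div_of_nonneg_right hC (by positivity))
      replace e2 := e2.trans (div_le_div_of_nonneg_right hC (by positivity))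
      replace b1 := b1.trans hB
      replace b2 := b2.trans hB
      constructor
      · rw [scaledCharlier_add_one ha0, hermiteFn_add_one]
        generalize √(2 * a) / a * (μ + a - ⌈a - x * √(2 * a)⌉₊) = c at *
        have e : c * scaledCharlier a x μ - 2 * μ * scaledCharlier a x (μ - 1) -
            (2 * x * hermiteFn μ x - 2 * μ * hermiteFn (μ - 1) x) =
            (c - 2 * x) * scaledCharlier a x μ +
              2 * x * (scaledCharlier a x μ - hermiteFn μ x) +
              -(2 * μ * (scaledCharlier a x (μ - 1) - hermiteFn (μ - 1) x)) := by ring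
        rw [e]
        refine (abs_add_three _ _ _).trans ?_
        rw [abs_neg, abs_mul, abs_mul, abs_mul, abs_mul, abs_mul, abs_two]
        calc _ ≤ 2 * ((N + 1) + 1) / √a * (B₁ + C₁) + 2 * X * (C₁ / √a) +
              2 * (N + 1) * (C₁ / √a) := by
              gcongr
              exact hc.trans (by gcongr)
          _ = (2 * (N + 2) * (B₁ + C₁) + 2 * X * C₁ + 2 * (N + 1) * C₁) / √a := by
              ring
          _ ≤ _ := div_le_div_of_nonneg_right (le_add_of_nonneg_left hC₁) (by positivity)
      · rw [hermiteFn_add_one]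
        refine (abs_sub _ _).trans ?_
        rw [abs_mul, abs_mul, abs_mul, abs_mul, abs_two]
        calc _ ≤ 2 * X * B₁ + 2 * (N + 1) * B₁ := by gcongr
          _ ≤ _ := le_add_of_nonneg_left hB₁

theorem scaledCharlier_uniform_bound (x₀ x₁ ν₀ ν₁ : ℝ) : ∃ C : ℝ, ∃ a₀ : ℝ, 0 < a₀ ∧
    ∀ a : ℝ, a₀ ≤ a → ∀ x ∈ Set.Icc x₀ x₁, ∀ ν ∈ Set.Icc ν₀ ν₁,
      0 ≤ ⌈a - x * √(2 * a)⌉ ∧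
      |scaledCharlier a x ν - hermiteFn ν x| ≤ C / √a := by
  obtain ⟨N, hN⟩ := exists_nat_gt ν₁
  have hX : 0 ≤ max |x₀| |x₁| := (abs_nonneg x₀).trans (le_max_left _ _)
  obtain ⟨C, B, h⟩ := exists_bound_of_lt_nat hX (le_max_left 2 |ν₀|) N
  refine ⟨C, 8 * (2 * max |x₀| |x₁| + 2) ^ 2, by positivity, fun a ha x hx ν hν ↦ ?_⟩
  have hxX : |x| ≤ max |x₀| |x₁| := abs_le_max_abs_abs hx.1 hx.2
  refine ⟨Int.ceil_nonneg (conditions_of_le ha hxX).2.2, (h a ha x ν hxX ?_ ?_).1⟩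
  · have h1 := le_max_right 2 |ν₀|
    have h2 := neg_abs_le ν₀
    linarith [hν.1]
  · linarith [hν.2]

/-! ### Degree two and sharpness -/

theorem hermiteFn_two (x : ℝ) : hermiteFn 2 x = 4 * x ^ 2 - 2 := by
  have hG : (Real.Gamma ((1 - 2) / 2))⁻¹ = -(1 / 2) * (√Real.pi)⁻¹ := by
    rw [inv_Gamma_eq, show ((1 - 2) / 2 + 1 : ℝ) = 1 / 2 by norm_num, Real.Gamma_one_half_eq]
    norm_num
  -- `1 / Γ(-1) = 0`
  have hG' : (Real.Gamma (-2 / 2))⁻¹ = 0 := by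
    rw [inv_Gamma_eq, show (-2 / 2 + 1 : ℝ) = 0 by norm_num, Real.Gamma_zero]
    norm_num
  have hM : kummerM (-2 / 2) (1 / 2) (x ^ 2) = 1 - 2 * x ^ 2 := by
    unfold kummerM
    rw [tsum_eq_sum (s := Finset.range 2)]
    · simp [Finset.sum_range_succ]
      ring
    · intro k hk
      have hk : 1 < k := by simpa using hk
      have := ascPochhammer_eval_neg_coe_nat_of_lt (R := ℝ) hk
      rw [show (-2 / 2 : ℝ) = -((1 : ℕ) : ℝ) by norm_num, this]
      simp
  unfold hermiteFn
  rw [hG, hG', hM, Real.rpow_two]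
  have : √Real.pi ≠ 0 := (Real.sqrt_pos.mpr Real.pi_pos).ne'
  field_simp
  ring

theorem charlier_two (a : ℝ) (n : ℕ) (ha : a ≠ 0) :
    charlier a n 2 = 1 - 2 * n / a + n * (n - 1) / a ^ 2 := by
  have h (k : ℕ) : ∏ j ∈ Finset.range (k + 3), ((2 : ℝ) - j) = 0 :=
    Finset.prod_eq_zero (i := 2) (by simp) (by norm_num)
  have e : charlier a n 2 = ∑ k ∈ Finset.range 3,
      (n.choose k : ℝ) * ((-a) ^ k)⁻¹ * ∏ j ∈ Finset.range k, ((2 : ℝ) - j) := by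
    have h₁ := Finset.sum_subset (Finset.range_subset_range.mpr (by omega : n + 1 ≤ n + 3))
      (f := fun k ↦ (n.choose k : ℝ) * ((-a) ^ k)⁻¹ * ∏ j ∈ Finset.range k, ((2 : ℝ) - j))
      fun k _ hk ↦ by simp [Nat.choose_eq_zero_of_lt (by simpa using hk : n < k)]
    have h₂ := Finset.sum_subset (Finset.range_subset_range.mpr (by omega : 3 ≤ n + 3))
      (f := fun k ↦ (n.choose k : ℝ) * ((-a) ^ k)⁻¹ * ∏ j ∈ Finset.range k, ((2 : ℝ) - j))
      fun k _ hk ↦ by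
        have := h (k - 3)
        rw [Nat.sub_add_cancel (by simpa using hk)] at this
        rw [this, mul_zero]
    rw [charlier_eq_sum_prod, h₁, h₂]
  rw [e]
  simp [Finset.sum_range_succ, Finset.prod_range_succ, Nat.cast_choose_two]
  field_simp
  ring

theorem scaledCharlier_two_sub {x a : ℝ} (ha : 0 < a) {n : ℕ} (hn : a - x * √(2 * a) = n) :
    scaledCharlier a x 2 - hermiteFn 2 x = 2 * √2 * x / √a := by
  unfold scaledCharlier
  rw [hn, Nat.ceil_natCast, charlier_two a n ha.ne', hermiteFn_two, ← hn, div_self two_ne_zero,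
    Real.rpow_one, Real.sqrt_mul zero_le_two]
  have hs : 0 < √a := Real.sqrt_pos.mpr ha
  obtain ⟨t, ht⟩ : ∃ t, t = √a := ⟨_, rfl⟩
  have hat : a = t ^ 2 := by rw [ht, Real.sq_sqrt ha.le]
  have h2 : √2 ^ 2 = 2 := Real.sq_sqrt zero_le_two
  rw [← ht] at hs ⊢
  rw [hat]
  generalize √2 = w at *
  field_simp
  linear_combination (2 * x ^ 2 * t ) * h2

theorem exists_sub_mul_sqrt_eq_natCast (x b : ℝ) :
    ∃ a : ℝ, b ≤ a ∧ 0 < a ∧ ∃ n : ℕ, a - x * √(2 * a) = (n : ℝ) := by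
  obtain ⟨n, hn⟩ := exists_nat_ge ((|x| + 2 * (|b| + 1)) ^ 2)
  -- `√a` is the positive root of `t² - √2 x t - n`
  obtain ⟨s, hs⟩ : ∃ s, s = √(x ^ 2 + 2 * n) := ⟨_, rfl⟩
  have hs2 : s ^ 2 = x ^ 2 + 2 * n := by rw [hs]; exact Real.sq_sqrt (by positivity)
  have hb : 0 ≤ |b| := abs_nonneg b
  have hs1 : |x| + 2 * (|b| + 1) ≤ s := by
    rw [hs]
    refine Real.le_sqrt_of_sq_le ?_
    nlinarith [sq_nonneg x]
  have ht : 2 * (|b| + 1) ≤ x + s := by linarith [neg_abs_le x]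
  have ht0 : 0 < x + s := by linarith
  refine ⟨(x + s) ^ 2 / 2, ?_, by positivity, n, ?_⟩
  · nlinarith [le_abs_self b]
  · rw [show 2 * ((x + s) ^ 2 / 2) = (x + s) ^ 2 by ring, Real.sqrt_sq (by linarith)]
    linear_combination hs2 / 2

theorem mainTheorem1 :
    -- uniform bound for `x` and `ν` in bounded intervals
    (∀ x₀ x₁ ν₀ ν₁ : ℝ, ∃ C : ℝ, ∃ a₀ : ℝ, 0 < a₀ ∧
      ∀ a : ℝ, a₀ ≤ a → ∀ x ∈ Set.Icc x₀ x₁, ∀ ν ∈ Set.Icc ν₀ ν₁,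
        0 ≤ ⌈a - x * √(2 * a)⌉ ∧
        |scaledCharlier a x ν - hermiteFn ν x| ≤ C / √a) ∧
    -- for `ν = 2` the error is explicit whenever `a - x√(2a)` is a non-negative integer
    (∀ x a : ℝ, 0 < a → (∃ n : ℕ, a - x * √(2 * a) = (n : ℝ)) →
      scaledCharlier a x 2 - hermiteFn 2 x = 2 * √2 * x / √a) ∧
    -- this happens, for every `x`, for arbitrarily large `a`
    (∀ x b : ℝ, ∃ a : ℝ, b ≤ a ∧ 0 < a ∧ ∃ n : ℕ, a - x * √(2 * a) = (n : ℝ)) ∧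
    -- the bound is sharp
    (∃ ν x c : ℝ, c ≠ 0 ∧ ∀ b : ℝ, ∃ a : ℝ, b ≤ a ∧ 0 < a ∧
      0 ≤ ⌈a - x * √(2 * a)⌉ ∧ scaledCharlier a x ν - hermiteFn ν x = c / √a) := by
  refine ⟨scaledCharlier_uniform_bound, fun x a ha ⟨n, hn⟩ ↦ scaledCharlier_two_sub ha hn,
    exists_sub_mul_sqrt_eq_natCast, 2, 1, 2 * √2, by positivity, fun b ↦ ?_⟩
  obtain ⟨a, hba, ha, n, hn⟩ := exists_sub_mul_sqrt_eq_natCast 1 b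
  refine ⟨a, hba, ha, ?_, by simpa using scaledCharlier_two_sub ha hn⟩
  rw [hn]
  exact Int.ceil_nonneg n.cast_nonneg
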